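/- Let $\mathcal H_1,\dots,\mathcal H_n$ be complex Hilbert spaces, $\mathcal H=\bigoplus_{j=1}^n\mathcal H_j$ their Hilbert direct sum, and for $1\le i,j\le n$ let $A_{ij}:\mathcal D(A_{ij})\subset\mathcal H_j\to\mathcal H_i$ be linear operators. Let $\mathcal M=(A_{ij})_{1\le i,j\le n}$ act in $\mathcal H$ by $(\mathcal M U)_i=\sum_{j}A_{ij}U_j$ on the domain $\mathcal D(\mathcal M)=\bigoplus_{j=1}^n\bigcap_{i=1}^n\mathcal D(A_{ij})$. Suppose that $\mathcal M$ is diagonally generalized subordinate with exponents less than $1$, that is, for all $i\ne j$ one has $\mathcal D(A_{jj})\subset\mathcal D(A_{ij})$ and there are given an integer $N^{(i,j)}\ge1$, exponents $p^{(i,j)}_1,\dots,p^{(i,j)}_{N^{(i,j)}}\in[0,1)$ and bounds $b^{(i,j)}_1,\dots,b^{(i,j)}_{N^{(i,j)}}\ge0$ such that $$\|A_{ij}u\|\le\sum_{k=1}^{N^{(i,j)}}b^{(i,j)}_k\|A_{jj}u\|^{p^{(i,j)}_k}\|u\|^{1-p^{(i,j)}_k}\qquad\text{for all }u\in\mathcal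 D(A_{jj}).$$ Let $(p_k)_{1\le k\le N}$ and $(b_k)_{1\le k\le N}$, with $N=\sum_{i\ne j}N^{(i,j)}$, be the joint families of all the $p^{(i,j)}_k$ and of all the $b^{(i,j)}_k$ with $i\neq j$. Suppose moreover that each diagonal entry $A_{jj}$ is normal, has compact resolvent, and has its spectrum on finitely many rays: $\sigma(A_{jj})\subset\bigcup_{l=1}^{m_j}e^{i\theta_{jl}}\mathbb R_{\ge0}$ with $\theta_{jl}\in\mathbb R$. Then $\mathcal M$ has compact resolvent, and for every $\alpha>\sum_{k=1}^Nb_k$ there exists $r_0>0$ such that $$\sigma(\mathcal M)\subset B_{r_0}(0)\cup\bigcup_{j=1}^n\bigcup_{l=1}^{m_j}\Big\{e^{i\theta_{jl}}(x+iy):\ x\ge0,\ |y|\le\max_{1\le k\le N}\alpha x^{p_k}\Big\}$$ (with $0^0=1$; for $n=1$ the families are empty, and the maximum and the sum are read as $0$). -/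

import Mathlib

noncomputable section

namespace OpMatrix

section Unbounded

variable {E : Type*} [NormedAddCommGroup E] [InnerProductSpace ℂ E]

/-- The bounded everywhere defined operator `R` is the two-sided inverse of
`T - z : D(T) → E`. -/
def IsResolventAt (T : E →ₗ.[ℂ] E) (z : ℂ) (R : E →L[ℂ] E) : Prop :=
  (∀ y : E, ∃ h : R y ∈ T.domain, T ⟨R y, h⟩ - z • R y = y) ∧
    ∀ x : T.domain, R (T x - z • (x : E)) = x

/-- The resolvent set of an unbounded operator. -/
def resolventSet (T : E →ₗ.[ℂ] E) : Set ℂ :=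
  {z | ∃ R : E →L[ℂ] E, IsResolventAt T z R}

/-- The spectrum of an unbounded operator. -/
def spectrum (T : E →ₗ.[ℂ] E) : Set ℂ :=
  (resolventSet T)ᶜ

/-- `T` has compact resolvent: `(T - z)⁻¹` exists and is compact for some `z` (equivalently, the
resolvent set is nonempty and `(T - z)⁻¹` is compact for every `z` in it). -/
def HasCompactResolvent (T : E →ₗ.[ℂ] E) : Prop :=
  ∃ (z : ℂ) (R : E →L[ℂ] E), IsResolventAt T z R ∧ IsCompactOperator R

/-- `T` is normal: densely defined, with `D(T) = D(T†)` and `‖T x‖ = ‖T† x‖` on this common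
domain (Weidmann's definition; such an operator is closed and satisfies `T†T = TT†`). -/
def IsNormalOp [CompleteSpace E] (T : E →ₗ.[ℂ] E) : Prop :=
  Dense (T.domain : Set E) ∧ T.domain = T.adjoint.domain ∧
    ∀ (x : T.domain) (y : T.adjoint.domain), (x : E) = y → ‖T x‖ = ‖T.adjoint y‖

/-- `S` is generalized subordinate to `T` with exponents `p` and bounds `b`. -/
def IsGeneralizedSubordinate {F G : Type*} [NormedAddCommGroup F] [InnerProductSpace ℂ F]
    [NormedAddCommGroup G] [InnerProductSpace ℂ G]
    (S : E →ₗ.[ℂ] F) (T : E →ₗ.[ℂ] G) {N : ℕ} (p b : Fin N → ℝ) : Prop :=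
  0 < N ∧ (∀ k, p k ∈ Set.Icc (0 : ℝ) 1) ∧ (∀ k, 0 ≤ b k) ∧
    ∃ h : T.domain ≤ S.domain, ∀ u : T.domain,
      ‖S ⟨u, h u.2⟩‖ ≤ ∑ k, b k * ‖T u‖ ^ p k * ‖(u : E)‖ ^ (1 - p k)

end Unbounded

section Matrix

variable {n : ℕ} {H : Fin n → Type*} [∀ j, NormedAddCommGroup (H j)]
  [∀ j, InnerProductSpace ℂ (H j)]

/-- The operator `(U_j)_j ↦ (∑ j, A i j U_j)_i` in the Hilbert direct sum of the `H j`, on its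
natural domain `⨁ j, ⋂ i, D(A i j)`. -/
def blockOperator (A : ∀ i j : Fin n, H j →ₗ.[ℂ] H i) : PiLp 2 H →ₗ.[ℂ] PiLp 2 H where
  domain :=
    { carrier := {U | ∀ i j, U j ∈ (A i j).domain}
      add_mem' := fun hU hV i j => (A i j).domain.add_mem (hU i j) (hV i j)
      zero_mem' := fun i j => (A i j).domain.zero_mem
      smul_mem' := fun c _ hU i j => (A i j).domain.smul_mem c (hU i j) }
  toFun :=
    { toFun := fun U => WithLp.toLp 2 fun i => ∑ j, A i j ⟨U.1 j, U.2 i j⟩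
      map_add' := fun U V => by
        ext i
        simp only [PiLp.add_apply, ← Finset.sum_add_distrib]
        exact Finset.sum_congr rfl fun j _ =>
          (A i j).map_add ⟨U.1 j, U.2 i j⟩ ⟨V.1 j, V.2 i j⟩
      map_smul' := fun c U => by
        ext i
        simp only [PiLp.smul_apply, RingHom.id_apply, Finset.smul_sum]
        exact Finset.sum_congr rfl fun j _ => (A i j).map_smul c ⟨U.1 j, U.2 i j⟩ }

/-- The operator matrix `A` is diagonally generalized subordinate: for `i ≠ j`, the entry `A i j`
is generalized subordinate to `A j j` with exponents `p i j` and bounds `b i j`. -/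
def IsDiagonallyGeneralizedSubordinate (A : ∀ i j : Fin n, H j →ₗ.[ℂ] H i)
    (N : Fin n → Fin n → ℕ) (p b : ∀ i j : Fin n, Fin (N i j) → ℝ) : Prop :=
  ∀ i j, i ≠ j → IsGeneralizedSubordinate (A i j) (A j j) (p i j) (b i j)

end Matrix

/-- Index set of the joint family of all the `p i j k` and `b i j k` with `i ≠ j`. -/
abbrev OffDiagIndex {n : ℕ} (N : Fin n → Fin n → ℕ) : Type :=
  Σ e : {e : Fin n × Fin n // e.1 ≠ e.2}, Fin (N e.1.1 e.1.2)

/-- The joint family of all the `c i j k` with `i ≠ j`. -/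
def joint {n : ℕ} {N : Fin n → Fin n → ℕ} (c : ∀ i j : Fin n, Fin (N i j) → ℝ) :
    OffDiagIndex N → ℝ :=
  fun k => c k.1.1.1 k.1.1.2 k.2

/-- The ray `e^{iθ} ℝ_{≥ 0}`. -/
def ray (θ : ℝ) : Set ℂ :=
  {z | ∃ x : ℝ, 0 ≤ x ∧ z = Complex.exp (θ * Complex.I) * x}

/-- `{e^{iθ} (x + i y) : x ≥ 0, |y| ≤ max_k α x ^ p_k}`. The supremum is over a finite family, so
it is a maximum; for the empty family (a `1 × 1` matrix) it is `0`. -/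
def parabolicRegion {ι : Type*} [Fintype ι] (p : ι → ℝ) (α θ : ℝ) : Set ℂ :=
  {z | ∃ x y : ℝ, 0 ≤ x ∧ |y| ≤ (⨆ k, α * x ^ p k) ∧
    z = Complex.exp (θ * Complex.I) * (x + y * Complex.I)}

end OpMatrix

end

/-! Subordination gives `M` the domain of its diagonal part `D`, and for `z` in the resolvent set of
every `A j j` one has `M - z = (1 + C) (D - z)`, where `C` has entries `A i j (A j j - z)⁻¹` off the
diagonal and zeros on it. If the norms of these entries sum to less than `1`, a Neumann series
inverts `1 + C`, and `(M - z)⁻¹ = (D - z)⁻¹ (1 + C)⁻¹` is compact because `(D - z)⁻¹` is.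

To estimate the entries, let `0 < d ≤ ‖z‖` be a lower bound for the distance from `z` to all the
rays. Normality gives `‖(A j j - z)⁻¹‖ ≤ 1 / d`, and an inversion argument on rays gives `‖A j j (A
j j - z)⁻¹‖ ≤ ‖z‖ / d`. Inserted into the subordination inequality, these bound the sum of the entry
norms by `(∑ k, b k * ‖z‖ ^ p k) / d`. The criterion is thus `∑ k, b k * ‖z‖ ^ p k < d`
(`exists_resolvent_of_lt_dist_rays`).

Since all exponents are below `1`, the criterion holds far out along a direction off the rays, and
also for large `z` outside the parabolic regions (`exists_sum_rpow_lt_dist_ray`). -/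

namespace OpMatrix

/-! ### Resolvent identity, compactness and spectral mapping -/

section Resolvent

variable {E : Type*} [NormedAddCommGroup E] [InnerProductSpace ℂ E]

/-- The first resolvent identity. -/
theorem IsResolventAt.resolvent_identity {T : E →ₗ.[ℂ] E} {z w : ℂ} {R Q : E →L[ℂ] E}
    (hR : IsResolventAt T z R) (hQ : IsResolventAt T w Q) :
    Q - R = (w - z) • (Q * R) := by
  ext y
  obtain ⟨h, hy⟩ := hR.1 y
  have h1 := hQ.2 ⟨R y, h⟩
  have h2 : T ⟨R y, h⟩ - w • R y = y + (z - w) • R y := by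
    rw [sub_eq_iff_eq_add.mp hy, sub_smul]
    abel
  simp only [h2, map_add, map_smul] at h1
  change Q y - R y = (w - z) • Q (R y)
  rw [sub_eq_iff_eq_add]
  nth_rewrite 2 [← h1]
  rw [sub_smul, sub_smul]
  abel

/-- If one resolvent of `T` is compact, then every resolvent of `T` is compact. -/
theorem IsResolventAt.isCompactOperator {T : E →ₗ.[ℂ] E} {z : ℂ} {R : E →L[ℂ] E}
    (hR : IsResolventAt T z R) (hT : HasCompactResolvent T) : IsCompactOperator R := by
  obtain ⟨w, Q, hQ, hc⟩ := hT
  have h : R = Q ∘L (1 + (z - w) • R) := by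
    ext y
    have hy : Q y - R y = (w - z) • Q (R y) :=
      congrArg (fun F : E →L[ℂ] E => F y) (hR.resolvent_identity hQ)
    change R y = Q (y + (z - w) • R y)
    rw [map_add, map_smul, ← neg_sub w z, neg_smul, ← hy]
    abel
  rw [h]
  exact hc.comp_clm _

/-- A nonzero point `μ` of the spectrum of the resolvent at `z` comes from the point `z + μ⁻¹` of
the spectrum of the unbounded operator. -/
theorem IsResolventAt.add_inv_mem_spectrum {T : E →ₗ.[ℂ] E} {z μ : ℂ} {R : E →L[ℂ] E}
    (hR : IsResolventAt T z R) (hμ : μ ≠ 0) (h : μ ∈ _root_.spectrum ℂ R) :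
    z + μ⁻¹ ∈ spectrum T := by
  rintro ⟨Q, hQ⟩
  have h1 : Q - R = μ⁻¹ • (Q * R) := by simpa using hR.resolvent_identity hQ
  have h2 : Q - R = μ⁻¹ • (R * Q) := by
    have := hQ.resolvent_identity hR
    rw [← neg_sub R Q, this, ← neg_smul]
    simp
  -- With `w = z + μ⁻¹`, formally `μ - R = μ (T - w) (T - z)⁻¹`, so its inverse should be `μ⁻¹ (T -
  -- z) (T - w)⁻¹ = μ⁻¹ (1 + μ⁻¹ Q)`.
  have e1 : (μ • (1 : E →L[ℂ] E) - R) * (1 + μ⁻¹ • Q) = μ • 1 := by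
    have : (μ • (1 : E →L[ℂ] E) - R) * (1 + μ⁻¹ • Q) = μ • 1 + (Q - R) - μ⁻¹ • (R * Q) := by
      simp only [sub_mul, mul_add, mul_one, mul_smul_comm, smul_mul_assoc, one_mul, smul_sub,
        inv_smul_smul₀ hμ]
      abel
    rw [this, ← h2, add_sub_cancel_right]
  have e2 : (1 + μ⁻¹ • Q) * (μ • (1 : E →L[ℂ] E) - R) = μ • 1 := by
    have : (1 + μ⁻¹ • Q) * (μ • (1 : E →L[ℂ] E) - R) = μ • 1 + (Q - R) - μ⁻¹ • (Q * R) := by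
      simp only [mul_sub, add_mul, mul_one, mul_smul_comm, smul_mul_assoc, one_mul, smul_add,
        smul_inv_smul₀ hμ]
      abel
    rw [this, ← h1, add_sub_cancel_right]
  refine h (_root_.spectrum.mem_resolventSet_of_left_right_inverse
    (b := μ⁻¹ • (1 + μ⁻¹ • Q)) (c := μ⁻¹ • (1 + μ⁻¹ • Q)) ?_ ?_)
  · rw [Algebra.algebraMap_eq_smul_one, mul_smul_comm, e1, inv_smul_smul₀ hμ]
  · rw [Algebra.algebraMap_eq_smul_one, smul_mul_assoc, e2, inv_smul_smul₀ hμ]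

end Resolvent

/-! ### Resolvent estimates for normal operators -/

section Normal

variable {E : Type*} [NormedAddCommGroup E] [InnerProductSpace ℂ E] [CompleteSpace E]

/-- The adjoint of the resolvent of `T` at `z` is a right inverse of `T† - conj z`. -/
theorem IsResolventAt.adjoint_apply {T : E →ₗ.[ℂ] E} {z : ℂ} {R : E →L[ℂ] E}
    (hR : IsResolventAt T z R) (hT : Dense (T.domain : Set E)) (v : E) :
    ∃ h : R.adjoint v ∈ T.adjoint.domain,
      T.adjoint ⟨R.adjoint v, h⟩ - star z • R.adjoint v = v := by
  have key : ∀ x : T.domain,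
      inner ℂ (v + star z • R.adjoint v) (x : E) = inner ℂ (R.adjoint v) (T x) := by
    intro x
    have h1 : inner ℂ (R.adjoint v) (T x - z • (x : E)) = inner ℂ v (x : E) := by
      rw [ContinuousLinearMap.adjoint_inner_left, hR.2 x]
    rw [inner_sub_right, inner_smul_right] at h1
    rw [inner_add_left, inner_smul_left, ← h1]
    simp
  refine ⟨LinearPMap.mem_adjoint_domain_of_exists _ ⟨_, key⟩, ?_⟩
  rw [LinearPMap.adjoint_apply_eq hT _ key]
  simp

/-- For a normal operator, `T - z` and `T† - conj z` have the same norms. -/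
theorem IsNormalOp.norm_sub_smul_eq {T : E →ₗ.[ℂ] E} (hT : IsNormalOp T) (z : ℂ)
    (x : T.domain) (y : T.adjoint.domain) (hxy : (x : E) = y) :
    ‖T x - z • (x : E)‖ = ‖T.adjoint y - star z • (x : E)‖ := by
  have h1 := hT.2.2 x y hxy
  have h2 : inner ℂ (T.adjoint y) (x : E) = inner ℂ (x : E) (T x) := by
    rw [LinearPMap.adjoint_isFormalAdjoint hT.1 y x, hxy]
  have h3 : ‖T x - z • (x : E)‖ ^ 2 = ‖T.adjoint y - star z • (x : E)‖ ^ 2 := by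
    rw [@norm_sub_sq ℂ, @norm_sub_sq ℂ, norm_smul, norm_smul, h1, norm_star, inner_smul_right,
      inner_smul_right, h2]
    congr 3
    rw [← inner_conj_symm (T x) (x : E)]
    simp only [RCLike.re_to_complex, Complex.mul_re, Complex.conj_re, Complex.conj_im,
      Complex.star_def]
    ring
  exact (sq_eq_sq₀ (norm_nonneg _) (norm_nonneg _)).mp h3

/-- Two linear maps with equal norms have equal inner products. -/
theorem inner_eq_of_norm_eq {D F : Type*} [AddCommGroup D] [Module ℂ D] [NormedAddCommGroup F]
    [InnerProductSpace ℂ F] (B C : D →ₗ[ℂ] F) (h : ∀ x, ‖B x‖ = ‖C x‖) (x y : D) :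
    inner ℂ (B x) (B y) = inner ℂ (C x) (C y) := by
  rw [inner_eq_sum_norm_sq_div_four, inner_eq_sum_norm_sq_div_four]
  simp only [← map_smul, ← map_add, ← map_sub, h]

/-- The resolvents of a normal operator are normal. -/
theorem IsNormalOp.isStarNormal {T : E →ₗ.[ℂ] E} (hT : IsNormalOp T) {z : ℂ} {R : E →L[ℂ] E}
    (hR : IsResolventAt T z R) : IsStarNormal R := by
  let B : T.domain →ₗ[ℂ] E := T.toFun - z • T.domain.subtype
  let C : T.domain →ₗ[ℂ] E :=
    T.adjoint.toFun ∘ₗ Submodule.inclusion hT.2.1.le - star z • T.domain.subtype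
  have hBC : ∀ x, ‖B x‖ = ‖C x‖ := fun x =>
    hT.norm_sub_smul_eq z x ⟨x, hT.2.1.le x.2⟩ rfl
  have hRB : ∀ x : T.domain, R (B x) = x := hR.2
  have hBR : ∀ y, ∃ h : R y ∈ T.domain, B ⟨R y, h⟩ = y := hR.1
  have hCR : ∀ y, ∃ h : R.adjoint y ∈ T.domain, C ⟨R.adjoint y, h⟩ = y := by
    intro y
    obtain ⟨h, hy⟩ := hR.adjoint_apply hT.1 y
    exact ⟨hT.2.1.ge h, hy⟩
  -- A right inverse of `C` is also a left inverse once `C` is injective, which it inherits from `B`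
  -- through equality of norms.
  have hRC : ∀ x : T.domain, R.adjoint (C x) = x := by
    intro x
    obtain ⟨h, hy⟩ := hCR (C x)
    have h0 : ‖C (⟨R.adjoint (C x), h⟩ - x)‖ = 0 := by rw [map_sub, hy]; simp
    rw [← hBC, norm_eq_zero] at h0
    have := hRB (⟨R.adjoint (C x), h⟩ - x)
    rw [h0, map_zero] at this
    exact sub_eq_zero.mp this.symm
  refine ⟨?_⟩
  change R.adjoint * R = R * R.adjoint
  ext y
  change R.adjoint (R y) = R (R.adjoint y)
  obtain ⟨h, hy⟩ := hBR (R.adjoint y)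
  -- Tested against `v = C R† v`: `⟨C R R† y, C R† v⟩ = ⟨B R R† y, B R† v⟩ = ⟨R† y, B R† v⟩ = ⟨y, R†
  -- v⟩ = ⟨R y, v⟩`.
  suffices hs : C ⟨R (R.adjoint y), h⟩ = R y by rw [← hs, hRC]
  refine ext_inner_right ℂ fun v => ?_
  obtain ⟨h', hv⟩ := hCR v
  conv_lhs => rw [← hv]
  rw [← inner_eq_of_norm_eq B C hBC, hy, ContinuousLinearMap.adjoint_inner_left, hRB]
  exact ContinuousLinearMap.adjoint_inner_right R y v

/-- The norm of a normal operator is bounded by any bound of its spectrum. -/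
theorem norm_le_of_forall_mem_spectrum {a : E →L[ℂ] E} (ha : IsStarNormal a) {c : ℝ} (hc : 0 ≤ c)
    (h : ∀ k ∈ _root_.spectrum ℂ a, ‖k‖ ≤ c) : ‖a‖ ≤ c := by
  lift c to NNReal using hc
  have h1 : spectralRadius ℂ a ≤ c := iSup₂_le fun k hk => by exact_mod_cast h k hk
  rw [IsStarNormal.spectralRadius_eq_nnnorm] at h1
  exact_mod_cast h1

/-- The resolvent of a normal operator is bounded by the inverse distance to the spectrum. -/
theorem IsNormalOp.norm_resolvent_le {T : E →ₗ.[ℂ] E} (hT : IsNormalOp T) {z : ℂ} {R : E →L[ℂ] E}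
    (hR : IsResolventAt T z R) {d : ℝ} (hd : 0 < d) (h : ∀ l ∈ spectrum T, d ≤ ‖z - l‖) :
    ‖R‖ ≤ d⁻¹ := by
  refine norm_le_of_forall_mem_spectrum (hT.isStarNormal hR) (by positivity) fun k hk => ?_
  rcases eq_or_ne k 0 with rfl | hk0
  · simpa using hd.le
  · have h1 := h _ (hR.add_inv_mem_spectrum hk0 hk)
    rw [sub_add_cancel_left, norm_neg, norm_inv] at h1
    exact (le_inv_comm₀ hd (norm_pos_iff.mpr hk0)).mp h1

/-- A bound for `T (T - z)⁻¹`, where `T` is normal. -/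
theorem IsNormalOp.norm_one_add_smul_resolvent_le {T : E →ₗ.[ℂ] E} (hT : IsNormalOp T) {z : ℂ}
    {R : E →L[ℂ] E} (hR : IsResolventAt T z R) {c : ℝ} (hc : 1 ≤ c)
    (h : ∀ l ∈ spectrum T, ‖l‖ ≤ c * ‖z - l‖) : ‖1 + z • R‖ ≤ c := by
  have hn := hT.isStarNormal hR
  have hn' : IsStarNormal (1 + z • R) := by
    have h0 : Commute R (star R) := hn.star_comm_self.symm
    refine ⟨?_⟩
    rw [star_add, star_one, star_smul]
    exact (((Commute.one_left _).add_left ((Commute.one_right _).add_right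
      ((h0.symm.smul_left _).smul_right _))))
  refine norm_le_of_forall_mem_spectrum hn' (by linarith) fun k hk => ?_
  -- The value `k = 1` corresponds to `0` in the spectrum of `R`, which comes from no point of the
  -- spectrum of `T`; `1 ≤ c` is there for this case.
  rcases eq_or_ne k 1 with rfl | hk1
  · simpa using hc
  have hk1' : k - 1 ≠ 0 := sub_ne_zero.mpr hk1
  have h1 : k - 1 ∈ _root_.spectrum ℂ (z • R) := by
    rw [← _root_.spectrum.add_mem_add_iff (s := 1)]
    simpa using hk
  have hz : z ≠ 0 := by
    rintro rfl
    rw [zero_smul, _root_.spectrum.mem_iff, sub_zero] at h1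
    exact h1 ((isUnit_iff_ne_zero.mpr hk1').map _)
  have h2 : (k - 1) / z ∈ _root_.spectrum ℂ R := by
    rw [← _root_.spectrum.smul_mem_smul_iff (r := Units.mk0 z hz)]
    simp only [Units.smul_mk0, smul_eq_mul, mul_div_cancel₀ _ hz]
    exact h1
  have h3 := h _ (hR.add_inv_mem_spectrum (div_ne_zero hk1' hz) h2)
  -- For the spectral point `l = z + z / (k - 1)` this gives `‖k‖ = ‖l‖ / ‖z - l‖`.
  have h4 : z + ((k - 1) / z)⁻¹ = k * (z / (k - 1)) := by field_simp; ring
  have h5 : z - (z + ((k - 1) / z)⁻¹) = -(z / (k - 1)) := by rw [inv_div]; ring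
  rw [h5, h4, norm_neg, norm_mul] at h3
  exact le_of_mul_le_mul_right h3 (norm_pos_iff.mpr (div_ne_zero hz hk1'))

end Normal

end OpMatrix

namespace OpMatrix

/-! ### Distances to rays and sublinear growth -/

section Rays

open Filter Topology

/-- A finite sum of powers with exponents less than `1` grows sublinearly. -/
theorem exists_sum_rpow_lt {ι : Type*} [Fintype ι] {p b : ι → ℝ} (hp : ∀ k, p k < 1) {η : ℝ}
    (hη : 0 < η) : ∃ r : ℝ, 0 < r ∧ ∀ t, r ≤ t → ∑ k, b k * t ^ p k < η * t := by
  have h1 : ∀ k, (fun t : ℝ => b k * t ^ p k) =o[atTop] fun t : ℝ => t := by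
    intro k
    refine Asymptotics.IsLittleO.const_mul_left ?_ _
    refine (Asymptotics.isLittleO_iff_tendsto' ?_).mpr ?_
    · filter_upwards [eventually_gt_atTop 0] with t ht h0
      exact absurd h0 ht.ne'
    · refine (tendsto_rpow_neg_atTop (sub_pos.mpr (hp k))).congr' ?_
      filter_upwards [eventually_gt_atTop 0] with t ht
      rw [neg_sub, Real.rpow_sub ht, Real.rpow_one]
  have h2 : (fun t : ℝ => ∑ k, b k * t ^ p k) =o[atTop] fun t : ℝ => t :=
    Asymptotics.IsLittleO.fun_sum fun k _ => h1 k
  obtain ⟨r, hr⟩ := eventually_atTop.mp (h2.bound (half_pos hη))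
  refine ⟨max r 1, by positivity, fun t ht => ?_⟩
  have ht0 : 0 < t := lt_of_lt_of_le (by positivity) ht
  have h3 := hr t ((le_max_left _ _).trans ht)
  rw [Real.norm_of_nonneg ht0.le] at h3
  nlinarith [Real.le_norm_self (∑ k, b k * t ^ p k), mul_pos hη ht0]

/-- A complex number in polar coordinates relative to the direction `exp (θ * I)`. -/
theorem exists_eq_exp_mul (θ : ℝ) (z : ℂ) :
    ∃ w : ℂ, z = Complex.exp (θ * Complex.I) * w ∧ ‖w‖ = ‖z‖ := by
  refine ⟨z / Complex.exp (θ * Complex.I), (mul_div_cancel₀ _ (Complex.exp_ne_zero _)).symm, ?_⟩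
  rw [norm_div, Complex.norm_exp_ofReal_mul_I, div_one]

theorem norm_exp_mul_sub (θ : ℝ) (w t : ℂ) :
    ‖Complex.exp (θ * Complex.I) * w - Complex.exp (θ * Complex.I) * t‖ = ‖w - t‖ := by
  rw [← mul_sub, norm_mul, Complex.norm_exp_ofReal_mul_I, one_mul]

/-- If `d` is at most the distance from `z` to a ray, then `‖l‖ / ‖z - l‖ ≤ ‖z‖ / d` on the ray. -/
theorem mul_norm_le_of_mem_ray {θ d : ℝ} {z l : ℂ} (h : ∀ l ∈ ray θ, d ≤ ‖z - l‖)
    (hl : l ∈ ray θ) : d * ‖l‖ ≤ ‖z‖ * ‖z - l‖ := by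
  obtain ⟨w, rfl, hw⟩ := exists_eq_exp_mul θ z
  obtain ⟨t, ht, rfl⟩ := hl
  rcases ht.eq_or_lt with rfl | ht
  · simp only [Complex.ofReal_zero, mul_zero, norm_zero, sub_zero]
    positivity
  -- The test point is the image of `t` under inversion in the circle through `w`; it stays on the
  -- ray, and its distance to `w` is `‖w‖ * ‖w - t‖ / t`.
  have h1 := h _ ⟨‖w‖ ^ 2 / t, by positivity, rfl⟩
  have htc : (t : ℂ) ≠ 0 := by exact_mod_cast ht.ne'
  rw [norm_exp_mul_sub] at h1 ⊢
  rw [← hw, norm_mul, Complex.norm_exp_ofReal_mul_I, one_mul, Complex.norm_real,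
    Real.norm_of_nonneg ht.le]
  have h2 : ‖w‖ * ‖w - t‖ = ‖w - ((‖w‖ ^ 2 / t : ℝ) : ℂ)‖ * t := by
    have e1 : (starRingEnd ℂ) w * (w - t) = (starRingEnd ℂ) (((‖w‖ ^ 2 / t : ℝ) : ℂ) - w) * t := by
      rw [map_sub, Complex.conj_ofReal, mul_sub, sub_mul, Complex.conj_mul']
      push_cast
      rw [div_mul_cancel₀ _ htc]
    have e2 := congrArg norm e1
    rwa [norm_mul, norm_mul, RCLike.norm_conj, RCLike.norm_conj, Complex.norm_real,
      Real.norm_of_nonneg ht.le, norm_sub_rev _ w] at e2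
  rw [h2]
  exact mul_le_mul_of_nonneg_right h1 ht.le

/-- Outside a large ball and the parabolic region around a ray, the distance to the ray dominates
`∑ k, b k * ‖z‖ ^ p k`. -/
theorem exists_sum_rpow_lt_dist_ray {ι : Type*} [Fintype ι] {p b : ι → ℝ}
    (hp0 : ∀ k, 0 ≤ p k) (hp : ∀ k, p k < 1) (hb : ∀ k, 0 ≤ b k) {α : ℝ} (hα : ∑ k, b k < α) :
    ∃ r : ℝ, 0 < r ∧ ∀ z : ℂ, r ≤ ‖z‖ → ∑ k, b k * ‖z‖ ^ p k < ‖z‖ ∧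
      ∀ θ : ℝ, z ∉ parabolicRegion p α θ →
        ∃ d, ∑ k, b k * ‖z‖ ^ p k < d ∧ ∀ l ∈ ray θ, d ≤ ‖z - l‖ := by
  have hB : 0 ≤ ∑ k, b k := Finset.sum_nonneg fun k _ => hb k
  set B := ∑ k, b k with hBdef
  have hα0 : 0 < α := hB.trans_lt hα
  obtain ⟨ε, hε, hεα⟩ : ∃ ε : ℝ, 0 < ε ∧ (1 + ε) * B < α := by
    refine ⟨(α - B) / (B + 1), div_pos (by linarith) (by linarith), ?_⟩
    rw [add_mul, one_mul, div_mul_eq_mul_div, ← lt_sub_iff_add_lt', div_lt_iff₀ (by linarith)]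
    nlinarith
  -- Write `w = x + i y`. In the sector `|y| ≤ ε x`, `‖w‖ ≤ (1 + ε) x` costs at most a factor `1 +
  -- ε`, absorbed by `α`. Outside it, for `x ≥ 0`, `‖w‖ ≤ x + |y|` gives `|y| ≥ ε / (1 + ε) * ‖w‖`,
  -- and sublinear growth suffices.
  obtain ⟨r, hr0, hr⟩ := exists_sum_rpow_lt (b := b) hp (η := ε / (1 + ε)) (by positivity)
  refine ⟨r, hr0, fun z hz => ?_⟩
  have hW := hr _ hz
  have hW1 : ∑ k, b k * ‖z‖ ^ p k < ‖z‖ := by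
    refine hW.trans_le (mul_le_of_le_one_left (norm_nonneg _) ?_)
    rw [div_le_one (by positivity)]
    linarith
  refine ⟨hW1, fun θ hθ => ?_⟩
  obtain ⟨w, rfl, hw⟩ := exists_eq_exp_mul θ z
  rw [← hw] at hW hW1 ⊢
  have hle : ‖w‖ ≤ |w.re| + |w.im| := Complex.norm_le_abs_re_add_abs_im w
  rcases lt_or_ge w.re 0 with hx | hx
  -- On this side the closest point of the ray is the origin.
  · refine ⟨‖w‖, hW1, ?_⟩
    rintro _ ⟨t, ht, rfl⟩
    rw [norm_exp_mul_sub, ← sq_le_sq₀ (norm_nonneg _) (norm_nonneg _), Complex.sq_norm,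
      Complex.sq_norm, Complex.normSq_apply, Complex.normSq_apply]
    simp only [Complex.sub_re, Complex.ofReal_re, Complex.sub_im, Complex.ofReal_im, sub_zero]
    nlinarith
  · have hy : (⨆ k, α * w.re ^ p k) < |w.im| := by
      by_contra! hcon
      exact hθ ⟨w.re, w.im, hx, hcon, by rw [Complex.re_add_im]⟩
    have hy0 : 0 < |w.im| :=
      (Real.iSup_nonneg fun k => mul_nonneg hα0.le (Real.rpow_nonneg hx _)).trans_lt hy
    have hyk : ∀ k, α * w.re ^ p k ≤ |w.im| := fun k =>
      (le_ciSup (Set.finite_range fun k => α * w.re ^ p k).bddAbove k).trans hy.le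
    refine ⟨|w.im|, ?_, ?_⟩
    · rw [abs_of_nonneg hx] at hle
      rcases le_or_gt |w.im| (ε * w.re) with h | h
      · have h1 : ∀ k, ‖w‖ ^ p k ≤ (1 + ε) * (|w.im| / α) := by
          intro k
          calc ‖w‖ ^ p k ≤ ((1 + ε) * w.re) ^ p k :=
                Real.rpow_le_rpow (norm_nonneg _) (by linarith) (hp0 k)
            _ = (1 + ε) ^ p k * w.re ^ p k := Real.mul_rpow (by positivity) hx
            _ ≤ (1 + ε) * (|w.im| / α) := by
                refine mul_le_mul ?_ ?_ (Real.rpow_nonneg hx _) (by positivity)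
                · exact Real.rpow_le_self_of_one_le (by linarith) (hp k).le
                · rw [le_div_iff₀ hα0, mul_comm]
                  exact hyk k
        calc ∑ k, b k * ‖w‖ ^ p k ≤ ∑ k, b k * ((1 + ε) * (|w.im| / α)) :=
              Finset.sum_le_sum fun k _ => mul_le_mul_of_nonneg_left (h1 k) (hb k)
          _ = ((1 + ε) * B) * (|w.im| / α) := by rw [← Finset.sum_mul, ← hBdef]; ring
          _ < α * (|w.im| / α) := mul_lt_mul_of_pos_right hεα (by positivity)
          _ = |w.im| := mul_div_cancel₀ _ hα0.ne'
      · refine hW.trans_le ?_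
        rw [div_mul_eq_mul_div, div_le_iff₀ (by positivity)]
        nlinarith
    · rintro _ ⟨t, ht, rfl⟩
      rw [norm_exp_mul_sub]
      simpa using Complex.abs_im_le_norm (w - t)

/-- There is a point whose distance to finitely many rays dominates
`∑ k, b k * ‖z‖ ^ p k`. -/
theorem exists_forall_sum_rpow_lt_dist_ray {ι κ : Type*} [Fintype ι] [Finite κ] {p b : ι → ℝ}
    (hp : ∀ k, p k < 1) (θ : κ → ℝ) :
    ∃ (z : ℂ) (d : ℝ), ∑ k, b k * ‖z‖ ^ p k < d ∧ d ≤ ‖z‖ ∧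
      ∀ j, ∀ l ∈ ray (θ j), d ≤ ‖z - l‖ := by
  -- A slope different from that of every ray. Vertical rays contribute the harmless value `0` and
  -- are never parallel to `1 + s i`.
  obtain ⟨s, hs⟩ := (Set.finite_range fun j => Real.sin (θ j) / Real.cos (θ j)).exists_notMem
  have hs' : ∀ j, s * Real.cos (θ j) - Real.sin (θ j) ≠ 0 := by
    intro j h
    rcases eq_or_ne (Real.cos (θ j)) 0 with h0 | h0
    · have := Real.sin_sq_add_cos_sq (θ j)
      rw [h0, mul_zero, zero_sub, neg_eq_zero] at h
      simp [h, h0] at this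
    · exact hs ⟨j, by rw [div_eq_iff h0]; linarith⟩
  set e : ℂ := 1 + s * Complex.I with he
  have he0 : 0 < ‖e‖ := by
    rw [norm_pos_iff]
    intro h
    simpa [he] using congrArg Complex.re h
  -- The quotient is the distance from `e / ‖e‖` to the line spanned by the ray; scaling to norm `r`
  -- gives distance at least `η * r`.
  obtain ⟨η, hη0, hη1, hη⟩ : ∃ η : ℝ, 0 < η ∧ η ≤ 1 ∧
      ∀ j, η ≤ |s * Real.cos (θ j) - Real.sin (θ j)| / ‖e‖ := by
    have h1 : ∀ᶠ η : ℝ in 𝓝[>] 0, ∀ j, η ≤ |s * Real.cos (θ j) - Real.sin (θ j)| / ‖e‖ := by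
      refine eventually_all.mpr fun j => ?_
      have : 0 < |s * Real.cos (θ j) - Real.sin (θ j)| / ‖e‖ :=
        div_pos (abs_pos.mpr (hs' j)) he0
      exact nhdsWithin_le_nhds (Iic_mem_nhds this)
    have h2 : ∀ᶠ η : ℝ in 𝓝[>] 0, η ≤ 1 := nhdsWithin_le_nhds (Iic_mem_nhds one_pos)
    obtain ⟨η, h3, h4, h5⟩ := (h1.and (h2.and self_mem_nhdsWithin)).exists
    exact ⟨η, h5, h4, h3⟩
  obtain ⟨r, hr0, hr⟩ := exists_sum_rpow_lt (b := b) hp hη0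
  have hz : ‖((r / ‖e‖ : ℝ) : ℂ) * e‖ = r := by
    rw [norm_mul, Complex.norm_real, Real.norm_of_nonneg (by positivity),
      div_mul_cancel₀ _ he0.ne']
  refine ⟨((r / ‖e‖ : ℝ) : ℂ) * e, η * r, ?_, ?_, fun j l hl => ?_⟩
  · rw [hz]
    exact hr r le_rfl
  · rw [hz]
    exact mul_le_of_le_one_left hr0.le hη1
  · obtain ⟨t, -, rfl⟩ := hl
    obtain ⟨w, hw, -⟩ := exists_eq_exp_mul (θ j) e
    have him : w.im = s * Real.cos (θ j) - Real.sin (θ j) := by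
      have h1 : w = Complex.exp (-(θ j : ℂ) * Complex.I) * e := by
        rw [hw, ← mul_assoc, ← Complex.exp_add]
        simp
      rw [h1, he, ← Complex.ofReal_neg, Complex.exp_mul_I, ← Complex.ofReal_cos,
        ← Complex.ofReal_sin, Real.cos_neg, Real.sin_neg]
      simp only [Complex.mul_im, Complex.add_re, Complex.add_im, Complex.ofReal_re,
        Complex.ofReal_im, Complex.mul_re, Complex.I_re, Complex.I_im, Complex.one_re,
        Complex.one_im]
      ring
    rw [hw, mul_left_comm, norm_exp_mul_sub, ← hw]
    calc η * r ≤ |s * Real.cos (θ j) - Real.sin (θ j)| / ‖e‖ * r :=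
          mul_le_mul_of_nonneg_right (hη j) hr0.le
      _ = |(r / ‖e‖) * w.im| := by
          rw [abs_mul, abs_of_nonneg (by positivity : 0 ≤ r / ‖e‖), him]
          ring
      _ ≤ ‖((r / ‖e‖ : ℝ) : ℂ) * w - t‖ := by
          simpa using Complex.abs_im_le_norm (((r / ‖e‖ : ℝ) : ℂ) * w - t)

end Rays

end OpMatrix

namespace OpMatrix

/-! ### Subordinate operators composed with a resolvent -/

section Perturbation

variable {E F : Type*} [NormedAddCommGroup E] [InnerProductSpace ℂ E]
  [NormedAddCommGroup F] [InnerProductSpace ℂ F]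

/-- If `S` is generalized subordinate to `T`, then `S (T - z)⁻¹` is bounded. -/
theorem IsGeneralizedSubordinate.exists_comp_resolvent {S : E →ₗ.[ℂ] F} {T : E →ₗ.[ℂ] E} {N : ℕ}
    {p b : Fin N → ℝ} (hS : IsGeneralizedSubordinate S T p b) {z : ℂ} {R : E →L[ℂ] E}
    (hR : IsResolventAt T z R) {d : ℝ} (hd : 0 < d) (h1 : ‖R‖ ≤ d⁻¹)
    (h2 : ‖1 + z • R‖ ≤ ‖z‖ / d) :
    ∃ C : E →L[ℂ] F, ‖C‖ ≤ (∑ k, b k * ‖z‖ ^ p k) / d ∧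
      ∀ v, ∃ h : R v ∈ S.domain, S ⟨R v, h⟩ = C v := by
  obtain ⟨-, hp, hb, hdom, hbound⟩ := hS
  have hmem : ∀ v, R v ∈ T.domain := fun v => (hR.1 v).1
  let L : E →ₗ[ℂ] F := S.toFun ∘ₗ (R : E →ₗ[ℂ] E).codRestrict S.domain fun v => hdom (hmem v)
  have hL : ∀ v, ‖L v‖ ≤ (∑ k, b k * ‖z‖ ^ p k) / d * ‖v‖ := by
    intro v
    obtain ⟨hv, hTv⟩ := hR.1 v
    have e1 : ‖R v‖ ≤ ‖v‖ / d := by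
      rw [div_eq_inv_mul]
      exact R.le_of_opNorm_le h1 v
    have e2 : ‖T ⟨R v, hv⟩‖ ≤ ‖z‖ * (‖v‖ / d) := by
      rw [sub_eq_iff_eq_add.mp hTv, mul_div_left_comm, mul_comm]
      exact (1 + z • R).le_of_opNorm_le h2 v
    have ha : 0 ≤ ‖v‖ / d := by positivity
    refine (hbound ⟨R v, hv⟩).trans ?_
    rw [div_mul_eq_mul_div, mul_div_assoc, Finset.sum_mul]
    refine Finset.sum_le_sum fun k _ => ?_
    rw [mul_assoc, mul_assoc]
    refine mul_le_mul_of_nonneg_left ?_ (hb k)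
    have hp0 := (hp k).1
    have hp1 : 0 ≤ 1 - p k := sub_nonneg.mpr (hp k).2
    -- The exponents add up to `1`, so every term carries the same factor `‖v‖ / d`, and only `‖z‖ ^
    -- p k` depends on `k`.
    calc ‖T ⟨R v, hv⟩‖ ^ p k * ‖R v‖ ^ (1 - p k)
        ≤ (‖z‖ * (‖v‖ / d)) ^ p k * (‖v‖ / d) ^ (1 - p k) := by gcongr
      _ = ‖z‖ ^ p k * (‖v‖ / d) := by
          rw [Real.mul_rpow (norm_nonneg _) ha, mul_assoc, ← Real.rpow_add_of_nonneg ha hp0 hp1,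
            add_sub_cancel, Real.rpow_one]
  refine ⟨L.mkContinuous _ hL, L.mkContinuous_norm_le ?_ hL, fun v => ⟨hdom (hmem v), rfl⟩⟩
  exact div_nonneg (Finset.sum_nonneg fun k _ => mul_nonneg (hb k) (by positivity)) hd.le

end Perturbation

/-! ### Block operators and the Neumann series -/

section Block

variable {n : ℕ} {H : Fin n → Type*} [∀ j, NormedAddCommGroup (H j)]
  [∀ j, InnerProductSpace ℂ (H j)]

variable (H) in
/-- The inclusion of a summand into the Hilbert direct sum. -/
noncomputable def summandInclusion (j : Fin n) : H j →ₗᵢ[ℂ] PiLp 2 H where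
  toFun x := PiLp.single 2 j x
  map_add' _ _ := PiLp.single_add 2 j
  map_smul' c x := by
    ext i
    exact congrFun (Pi.single_smul j c x) i
  norm_map' x := PiLp.norm_single 2 H j x

/-- The bounded operator on the Hilbert direct sum with entries `C i j`. -/
noncomputable def boundedBlock (C : ∀ i j, H j →L[ℂ] H i) : PiLp 2 H →L[ℂ] PiLp 2 H :=
  ∑ i, ∑ j, (summandInclusion H i).toContinuousLinearMap ∘L C i j ∘L PiLp.proj 2 H j

theorem boundedBlock_apply (C : ∀ i j, H j →L[ℂ] H i) (V : PiLp 2 H) (i : Fin n) :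
    boundedBlock C V i = ∑ j, C i j (V j) := by
  have h : boundedBlock C V = ∑ i, ∑ j, summandInclusion H i (C i j (V j)) := by
    simp [boundedBlock]
  rw [h, WithLp.ofLp_sum, Finset.sum_apply, Finset.sum_eq_single i]
  · rw [WithLp.ofLp_sum, Finset.sum_apply]
    exact Finset.sum_congr rfl fun j _ => PiLp.single_eq_same 2 i _
  · intro k _ hk
    rw [WithLp.ofLp_sum, Finset.sum_apply]
    exact Finset.sum_eq_zero fun j _ => PiLp.single_eq_of_ne 2 hk.symm _
  · simp

/-- Adding all entry norms is crude, but it matches the joint sum of the bounds `b`, the threshold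
for `α`. -/
theorem norm_boundedBlock_le (C : ∀ i j, H j →L[ℂ] H i) :
    ‖boundedBlock C‖ ≤ ∑ i, ∑ j, ‖C i j‖ := by
  have h : ∀ i j, ‖(summandInclusion H i).toContinuousLinearMap ∘L C i j ∘L PiLp.proj 2 H j‖ ≤
      ‖C i j‖ := by
    intro i j
    refine ContinuousLinearMap.opNorm_le_bound _ (norm_nonneg _) fun V => ?_
    rw [ContinuousLinearMap.comp_apply, ContinuousLinearMap.comp_apply,
      LinearIsometry.coe_toContinuousLinearMap, LinearIsometry.norm_map]
    exact (C i j).le_opNorm_of_le (PiLp.norm_apply_le V j)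
  unfold boundedBlock
  exact norm_sum_le_of_le (E := PiLp 2 H →L[ℂ] PiLp 2 H) Finset.univ fun i _ =>
    norm_sum_le_of_le (E := PiLp 2 H →L[ℂ] PiLp 2 H) Finset.univ fun j _ => h i j

/-- The bounded block diagonal operator on the Hilbert direct sum. -/
noncomputable def boundedDiagonal (R : ∀ j, H j →L[ℂ] H j) : PiLp 2 H →L[ℂ] PiLp 2 H :=
  ∑ j, (summandInclusion H j).toContinuousLinearMap ∘L R j ∘L PiLp.proj 2 H j

theorem boundedDiagonal_apply (R : ∀ j, H j →L[ℂ] H j) (V : PiLp 2 H) (i : Fin n) :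
    boundedDiagonal R V i = R i (V i) := by
  have h : boundedDiagonal R V = ∑ j, summandInclusion H j (R j (V j)) := by
    simp [boundedDiagonal]
  rw [h, WithLp.ofLp_sum, Finset.sum_apply, Finset.sum_eq_single i]
  · exact PiLp.single_eq_same 2 i _
  · exact fun k _ hk => PiLp.single_eq_of_ne 2 hk.symm _
  · simp

theorem isCompactOperator_boundedDiagonal {R : ∀ j, H j →L[ℂ] H j}
    (hR : ∀ j, IsCompactOperator (R j)) : IsCompactOperator (boundedDiagonal R) := by
  refine (compactOperator (RingHom.id ℂ) (PiLp 2 H) (PiLp 2 H)).sum_mem fun j _ => ?_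
  exact ((hR j).comp_clm (PiLp.proj 2 H j)).clm_comp (summandInclusion H j).toContinuousLinearMap

/-- The resolvent of an operator matrix whose off-diagonal entries are small relative to the
diagonal ones, by a Neumann series. -/
theorem exists_isResolventAt_blockOperator [∀ j, CompleteSpace (H j)]
    {A : ∀ i j : Fin n, H j →ₗ.[ℂ] H i} {z : ℂ} {R : ∀ j, H j →L[ℂ] H j}
    (hR : ∀ j, IsResolventAt (A j j) z (R j)) (hRc : ∀ j, IsCompactOperator (R j))
    {C : ∀ i j, H j →L[ℂ] H i} (hC0 : ∀ i, C i i = 0)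
    (hdom : ∀ i j, (A j j).domain ≤ (A i j).domain)
    (hC : ∀ i j, i ≠ j → ∀ v (h : R j v ∈ (A i j).domain), A i j ⟨R j v, h⟩ = C i j v)
    (hlt : ∑ i, ∑ j, ‖C i j‖ < 1) :
    ∃ Q, IsResolventAt (blockOperator A) z Q ∧ IsCompactOperator Q := by
  have hK : ‖-boundedBlock C‖ < 1 := by
    rw [norm_neg]
    exact (norm_boundedBlock_le C).trans_lt hlt
  obtain ⟨u, hu⟩ := isUnit_one_sub_of_norm_lt_one hK
  rw [sub_neg_eq_add] at hu
  have hu1 : ∀ V, boundedDiagonal R V ∈ (blockOperator A).domain := by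
    intro V i j
    rw [boundedDiagonal_apply]
    exact hdom i j ((hR j).1 (V j)).1
  -- The factorization `(M - z) (D - z)⁻¹ = 1 + C`.
  have hu2 : ∀ V (h : boundedDiagonal R V ∈ (blockOperator A).domain),
      blockOperator A ⟨boundedDiagonal R V, h⟩ - z • boundedDiagonal R V = (u : _ →L[ℂ] _) V := by
    intro V h
    rw [hu]
    ext i
    change (∑ j, A i j ⟨boundedDiagonal R V j, h i j⟩) - z • (boundedDiagonal R V i) =
      V i + boundedBlock C V i
    have hRi : A i i ⟨boundedDiagonal R V i, h i i⟩ - z • boundedDiagonal R V i = V i := by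
      obtain ⟨h', hV⟩ := (hR i).1 (V i)
      simp only [boundedDiagonal_apply, hV]
    have hRj : ∀ j ∈ Finset.univ.erase i, A i j ⟨boundedDiagonal R V j, h i j⟩ = C i j (V j) := by
      intro j hj
      have h' : R j (V j) ∈ (A i j).domain := by
        rw [← boundedDiagonal_apply R V j]
        exact h i j
      rw [← hC i j (Finset.ne_of_mem_erase hj).symm (V j) h']
      congr 1
      exact Subtype.ext (boundedDiagonal_apply R V j)
    rw [boundedBlock_apply, ← Finset.add_sum_erase _ _ (Finset.mem_univ i),
      ← Finset.add_sum_erase _ (fun j => C i j (V j)) (Finset.mem_univ i), hC0,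
      Finset.sum_congr rfl hRj, add_sub_right_comm, hRi]
    simp
  refine ⟨boundedDiagonal R ∘L ((u⁻¹ : (PiLp 2 H →L[ℂ] PiLp 2 H)ˣ) : PiLp 2 H →L[ℂ] PiLp 2 H),
    ⟨fun y => ⟨hu1 _, ?_⟩, fun x => ?_⟩,
    (isCompactOperator_boundedDiagonal hRc).comp_clm _⟩
  · refine (hu2 _ _).trans ?_
    exact congrArg (fun G : PiLp 2 H →L[ℂ] PiLp 2 H => G y) u.mul_inv
  -- Here `V = (D - z) x`, so that `x = (D - z)⁻¹ V` and the factorization applies.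
  · let V : PiLp 2 H :=
      WithLp.toLp 2 fun j => A j j ⟨(x : PiLp 2 H) j, x.2 j j⟩ - z • (x : PiLp 2 H) j
    have hV : boundedDiagonal R V = x := by
      ext j
      rw [boundedDiagonal_apply]
      exact (hR j).2 ⟨(x : PiLp 2 H) j, x.2 j j⟩
    have h1 : blockOperator A x - z • (x : PiLp 2 H) = (u : _ →L[ℂ] _) V := by
      rw [← hu2 V (hu1 V)]
      simp only [hV]
    rw [h1]
    refine Eq.trans ?_ hV
    exact congrArg (fun G : PiLp 2 H →L[ℂ] PiLp 2 H => boundedDiagonal R (G V)) u.inv_mul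

/-- The joint sum over the off-diagonal indices, as an iterated sum. -/
theorem sum_offDiagIndex (N : Fin n → Fin n → ℕ) (f : ∀ i j : Fin n, Fin (N i j) → ℝ) :
    ∑ k : OffDiagIndex N, f k.1.1.1 k.1.1.2 k.2 =
      ∑ i, ∑ j, if i = j then 0 else ∑ k, f i j k := by
  rw [Fintype.sum_sigma, ← Fintype.sum_prod_type']
  conv_rhs => enter [2, e]; rw [← ite_not]
  rw [← Finset.sum_filter]
  exact (Finset.sum_subtype (p := fun e : Fin n × Fin n => e.1 ≠ e.2) _ (by simp)
    fun e : Fin n × Fin n => ∑ k, f e.1 e.2 k).symm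

/-- A point whose distance to the rays dominates `∑ k, b k * ‖z‖ ^ p k` lies in the resolvent set
of the operator matrix. -/
theorem exists_resolvent_of_lt_dist_rays [∀ j, CompleteSpace (H j)]
    {A : ∀ i j : Fin n, H j →ₗ.[ℂ] H i} {N : Fin n → Fin n → ℕ}
    {p b : ∀ i j : Fin n, Fin (N i j) → ℝ} (hsub : IsDiagonallyGeneralizedSubordinate A N p b)
    (hnormal : ∀ j, IsNormalOp (A j j)) (hcompact : ∀ j, HasCompactResolvent (A j j))
    {m : Fin n → ℕ} {θ : ∀ j, Fin (m j) → ℝ}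
    (hrays : ∀ j, spectrum (A j j) ⊆ ⋃ l, ray (θ j l)) {z : ℂ} {d : ℝ}
    (hd : ∑ k, joint b k * ‖z‖ ^ joint p k < d) (hdz : d ≤ ‖z‖)
    (hdist : ∀ j l, ∀ w ∈ ray (θ j l), d ≤ ‖z - w‖) :
    ∃ Q, IsResolventAt (blockOperator A) z Q ∧ IsCompactOperator Q := by
  have hd0 : 0 < d := by
    refine lt_of_le_of_lt (Finset.sum_nonneg fun k _ => mul_nonneg ?_ (by positivity)) hd
    exact (hsub _ _ k.1.2).2.2.1 k.2
  have hres : ∀ j, ∃ R, IsResolventAt (A j j) z R := by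
    intro j
    by_contra hz
    obtain ⟨l, hl⟩ := Set.mem_iUnion.mp (hrays j hz)
    have := hdist j l z hl
    rw [sub_self, norm_zero] at this
    linarith
  choose R hR using hres
  have hR1 : ∀ j, ‖R j‖ ≤ d⁻¹ := fun j =>
    (hnormal j).norm_resolvent_le (hR j) hd0 fun w hw => by
      obtain ⟨l, hl⟩ := Set.mem_iUnion.mp (hrays j hw)
      exact hdist j l w hl
  have hR2 : ∀ j, ‖1 + z • R j‖ ≤ ‖z‖ / d := fun j =>
    (hnormal j).norm_one_add_smul_resolvent_le (hR j) ((one_le_div hd0).mpr hdz) fun w hw => by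
      obtain ⟨l, hl⟩ := Set.mem_iUnion.mp (hrays j hw)
      rw [div_mul_eq_mul_div, le_div_iff₀ hd0, mul_comm]
      exact mul_norm_le_of_mem_ray (hdist j l) hl
  have hCex : ∀ i j, ∃ C : H j →L[ℂ] H i,
      ‖C‖ ≤ (if i = j then 0 else (∑ k, b i j k * ‖z‖ ^ p i j k) / d) ∧
        (i ≠ j → ∀ v (h : R j v ∈ (A i j).domain), A i j ⟨R j v, h⟩ = C v) := by
    intro i j
    by_cases hij : i = j
    · exact ⟨0, by simp [hij], fun h => absurd hij h⟩
    · obtain ⟨C, hC1, hC2⟩ :=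
        (hsub i j hij).exists_comp_resolvent (hR j) hd0 (hR1 j) (hR2 j)
      exact ⟨C, by rwa [if_neg hij], fun _ v h => (hC2 v).2⟩
  choose C hC1 hC2 using hCex
  refine exists_isResolventAt_blockOperator hR (fun j => (hR j).isCompactOperator (hcompact j))
    (C := C) (fun i => ?_) (fun i j => ?_) hC2 ?_
  -- On the diagonal the norm bound is `0`, which forces `C i i = 0`.
  · simpa using hC1 i i
  · rcases eq_or_ne i j with rfl | hij
    · exact le_rfl
    · exact (hsub i j hij).2.2.2.1
  · calc ∑ i, ∑ j, ‖C i j‖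
        ≤ ∑ i, ∑ j, if i = j then 0 else ∑ k, b i j k * ‖z‖ ^ p i j k / d := by
          refine Finset.sum_le_sum fun i _ => Finset.sum_le_sum fun j _ => ?_
          simpa only [Finset.sum_div] using hC1 i j
      _ = (∑ k, joint b k * ‖z‖ ^ joint p k) / d := by
          rw [← sum_offDiagIndex N fun i j k => b i j k * ‖z‖ ^ p i j k / d, Finset.sum_div]
          rfl
      _ < 1 := (div_lt_one hd0).mpr hd

end Block

end OpMatrix

/-! ### Compact resolvent and spectral enclosure -/

theorem theorem2p3 {n : ℕ} {H : Fin n → Type*} [∀ j, NormedAddCommGroup (H j)]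
    [∀ j, InnerProductSpace ℂ (H j)] [∀ j, CompleteSpace (H j)]
    (A : ∀ i j : Fin n, H j →ₗ.[ℂ] H i)
    (N : Fin n → Fin n → ℕ) (p b : ∀ i j : Fin n, Fin (N i j) → ℝ)
    (hsub : OpMatrix.IsDiagonallyGeneralizedSubordinate A N p b)
    (hp : ∀ k, OpMatrix.joint p k < 1)
    (hnormal : ∀ j, OpMatrix.IsNormalOp (A j j))
    (hcompact : ∀ j, OpMatrix.HasCompactResolvent (A j j))
    (m : Fin n → ℕ) (θ : ∀ j, Fin (m j) → ℝ)
    (hrays : ∀ j, OpMatrix.spectrum (A j j) ⊆ ⋃ l, OpMatrix.ray (θ j l)) :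
    OpMatrix.HasCompactResolvent (OpMatrix.blockOperator A) ∧
      ∀ α : ℝ, ∑ k, OpMatrix.joint b k < α →
        ∃ r₀ : ℝ, 0 < r₀ ∧
          OpMatrix.spectrum (OpMatrix.blockOperator A) ⊆
            Metric.ball 0 r₀ ∪
              ⋃ j, ⋃ l, OpMatrix.parabolicRegion (OpMatrix.joint p) α (θ j l) := by
  refine ⟨?_, fun α hα => ?_⟩
  · obtain ⟨z, d, h1, h2, h3⟩ := OpMatrix.exists_forall_sum_rpow_lt_dist_ray (b := OpMatrix.joint b)
      hp fun jl : Σ j, Fin (m j) => θ jl.1 jl.2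
    exact ⟨z, OpMatrix.exists_resolvent_of_lt_dist_rays hsub hnormal hcompact hrays h1 h2
      fun j l => h3 ⟨j, l⟩⟩
  · obtain ⟨r, hr0, hr⟩ := OpMatrix.exists_sum_rpow_lt_dist_ray
      (p := OpMatrix.joint p) (b := OpMatrix.joint b)
      (fun k => ((hsub _ _ k.1.2).2.1 k.2).1) hp (fun k => (hsub _ _ k.1.2).2.2.1 k.2) hα
    refine ⟨r, hr0, fun z hz => ?_⟩
    by_contra hcon
    simp only [Set.mem_union, Metric.mem_ball, dist_zero_right, Set.mem_iUnion, not_or, not_lt,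
      not_exists] at hcon
    obtain ⟨hW, hθ⟩ := hr z hcon.1
    choose d hd hdist using fun jl : Σ j, Fin (m j) => hθ (θ jl.1 jl.2) (hcon.2 jl.1 jl.2)
    -- One distance bound must serve all rays and stay below `‖z‖`; a value just above the sum
    -- works, as there are finitely many strict inequalities, possibly none from rays.
    obtain ⟨e, he1, he2, he3⟩ : ∃ e, ∑ k, OpMatrix.joint b k * ‖z‖ ^ OpMatrix.joint p k < e ∧
        e ≤ ‖z‖ ∧ ∀ jl, e ≤ d jl := by
      set W := ∑ k, OpMatrix.joint b k * ‖z‖ ^ OpMatrix.joint p k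
      have h1 : ∀ᶠ e in nhdsWithin W (Set.Ioi W), ∀ jl, e ≤ d jl :=
        Filter.eventually_all.mpr fun jl => nhdsWithin_le_nhds (Iic_mem_nhds (hd jl))
      have h2 : ∀ᶠ e in nhdsWithin W (Set.Ioi W), e ≤ ‖z‖ :=
        nhdsWithin_le_nhds (Iic_mem_nhds hW)
      obtain ⟨e, h3, h4, h5⟩ := (h1.and (h2.and self_mem_nhdsWithin)).exists
      exact ⟨e, h5, h4, h3⟩
    obtain ⟨Q, hQ, -⟩ := OpMatrix.exists_resolvent_of_lt_dist_rays hsub hnormal hcompact hrays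
      he1 he2 fun j l w hw => (he3 ⟨j, l⟩).trans (hdist ⟨j, l⟩ w hw)
    exact hz ⟨Q, hQ⟩
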